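/- Let $d\ge 1$, let $X\subset\mathbb R^d$ be the closure of a bounded open convex set, and let $M_d$ be the space of real $d\times d$ matrices with the Frobenius inner product $A:B=\operatorname{tr}(A^TB)$. Write $S_d^+\subset M_d$ for the symmetric positive semidefinite matrices. Let $f:M_d\to[0,+\infty]$ be a function with $\{f<+\infty\}\subset S_d^+$ that is lower semicontinuous, coercive ($f(A)\to+\infty$ as $\|A\|\to\infty$), subadditive, and positively $1$-homogeneous ($f(tA)=tf(A)$ for all $t\ge 0$, with $0\cdot\infty=0$). Let $\mu,\nu$ be finite positive Borel measures on $\mathbb R^d$ supported in $X$ with $\mu(X)=\nu(X)$. For an $M_d$-valued measure $\lambda$, let $|\lambda|$ be its total variation and $\frac{d\lambda}{d|\lambda|}$ its density. Dynamic problem. Let $F(\mu,\nu)\in[0,+\infty]$ be the infimum of $$\int_0^1\int_X f\Big(\frac{d\lambda_t}{d|\lambda_t|}\Big)\,d|\lambda_t|\,dt$$ over all measurable families $(\varrho_t)_{t\in(0,1)}$ of positive measures and $(\lambda_t)_{t\in(0,1)}$ of $S_d^+$-valued measures on $\mathbb R^d$, supported in $X$ for a.e. $t$, with $\int_0^1\varrho_t(\mathbb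 R^d)\,dt<\infty$ and $\int_0^1|\lambda_t|(K)\,dt<\infty$ for every compact $K\subset\mathbb R^d$, which solve the Fokker–Planck equation $\partial_t\varrho=\operatorname{tr}(\tfrac12\nabla^2\lambda)$ in the sense that $$\int_0^1\int_{\mathbb R^d}\partial_t\varphi\,d\varrho_t\,dt=-\int_0^1\int_{\mathbb R^d}\tfrac12\nabla_x^2\varphi:d\lambda_t\,dt\qquad\text{for all }\varphi\in C_c^2((0,1)\times\mathbb R^d),$$ and satisfy $\varrho_0=\mu$, $\varrho_1=\nu$, where $\varrho_0,\varrho_1$ are the endpoint values of the narrowly continuous representative of $t\mapsto\varrho_t$ on $[0,1]$. Then $$F(\mu,\nu)=\inf_\lambda\int_X f\Big(\frac{d\lambda}{d|\lambda|}\Big)\,d|\lambda|,$$ where the infimum is over all $S_d^+$-valued measures $\lambda$ on $\mathbb R^d$ with $\operatorname{supp}\lambda\subset X$ and $\operatorname{tr}(\tfrac12\nabla^2\lambda)=\nu-\mu$, that is, $$\int_X\tfrac12\nabla^2\varphi:d\lambda=\int_X\varphi\,d\nu-\int_X\varphi\,d\mu\qquad\text{for all }\varphi\in C_c^2(\mathbb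 R^d).$$ Here $\inf\emptyset=+\infty$. -/

import Mathlib

open MeasureTheory Set Filter Topology
open scoped ENNReal NNReal BoundedContinuousFunction

noncomputable section

namespace FokkerPlanckOT

/-- The Euclidean space `ℝ^d`. -/
abbrev Space (d : ℕ) : Type := EuclideanSpace ℝ (Fin d)

/-- The space `M_d` of real `d × d` matrices. -/
abbrev Mat (d : ℕ) : Type := Matrix (Fin d) (Fin d) ℝ

/-- Finite Borel measures on `ℝ^d` with values in `M_d`. -/
abbrev MatMeasure (d : ℕ) : Type := VectorMeasure (Space d) (Mat d)

variable {d : ℕ}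

/-- The Frobenius inner product `A : B = tr (Aᵀ B)`. -/
def frob (A B : Mat d) : ℝ := (A.transpose * B).trace

/-- The Frobenius norm `‖A‖ = √(A : A)`. -/
def frobNorm (A : Mat d) : ℝ := √(frob A A)

/-- The standing assumptions on the cost `f : M_d → [0, +∞]`. -/
structure IsCost (f : Mat d → ℝ≥0∞) : Prop where
  /-- The effective domain is contained in the positive semidefinite symmetric matrices. -/
  posSemidef_of_ne_top : ∀ A, f A ≠ ∞ → A.PosSemidef
  coercive : Tendsto f (comap frobNorm atTop) (𝓝 ∞)
  subadditive : ∀ A B, f (A + B) ≤ f A + f B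
  /-- Positive 1-homogeneity, with the convention `0 * ∞ = 0`. -/
  homogeneous : ∀ (t : ℝ≥0) (A : Mat d), f ((t : ℝ) • A) = t * f A
  lowerSemicontinuous : LowerSemicontinuous f

/-- The measure takes its values in the symmetric positive semidefinite matrices. -/
def IsPSDValued (lam : MatMeasure d) : Prop :=
  ∀ B, MeasurableSet B → (lam B).PosSemidef

/-- The `(i, j)` entry of a matrix-valued measure, as a signed measure. -/
def entry (lam : MatMeasure d) (i j : Fin d) : SignedMeasure (Space d) :=
  lam.mapRange (Matrix.entryAddMonoidHom ℝ i j)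
    (continuous_id.matrix_elem i j)

/-- The isometry from `M_d`, with the Frobenius norm, to the Euclidean space of the entries. -/
def vecHom (d : ℕ) : Mat d →+ EuclideanSpace ℝ (Fin d × Fin d) where
  toFun A := WithLp.toLp 2 fun p => A p.1 p.2
  map_zero' := rfl
  map_add' _ _ := rfl

theorem norm_vecHom (A : Mat d) : ‖vecHom d A‖ = frobNorm A := by
  have h : ∀ p, vecHom d A p = A p.1 p.2 := fun _ => rfl
  simp only [EuclideanSpace.norm_eq, frobNorm, frob, Matrix.trace, Matrix.diag, Matrix.mul_apply,
    Matrix.transpose_apply, Fintype.sum_prod_type, h, Real.norm_eq_abs, sq_abs, ← sq]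
  rw [Finset.sum_comm]

theorem continuous_vecHom : Continuous (vecHom d) := by
  refine (PiLp.continuous_toLp 2 _).comp (continuous_pi fun p => ?_)
  exact continuous_id.matrix_elem p.1 p.2

/-- The total variation `|λ|` with respect to the Frobenius norm. -/
def totalVar (lam : MatMeasure d) : Measure (Space d) :=
  (lam.mapRange (vecHom d) continuous_vecHom).variation

/-- The density `dλ/d|λ|` with respect to the total variation, taken entry by entry. -/
def polarDensity (lam : MatMeasure d) (x : Space d) : Mat d :=
  Matrix.of fun i j => (entry lam i j).rnDeriv (totalVar lam) x

/-- `∫ ξ(x) : dλ(x)`, that is, `∫ ξ : (dλ/d|λ|) d|λ|`. -/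
def matIntegral (ξ : Space d → Mat d) (lam : MatMeasure d) : ℝ :=
  ∫ x, frob (ξ x) (polarDensity lam x) ∂totalVar lam

/-- The functional `∫_X f(dλ/d|λ|) d|λ|`. -/
def cost (f : Mat d → ℝ≥0∞) (X : Set (Space d)) (lam : MatMeasure d) : ℝ≥0∞ :=
  ∫⁻ x in X, f (polarDensity lam x) ∂totalVar lam

/-- The Hessian matrix of a function on `ℝ^d`. -/
def hessian (ψ : Space d → ℝ) (x : Space d) : Mat d :=
  Matrix.of fun i j =>
    iteratedFDeriv ℝ 2 ψ x ![EuclideanSpace.single i 1, EuclideanSpace.single j 1]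

/-- Lebesgue measure on the time interval `(0, 1)`. -/
def timeMeasure : Measure ℝ := volume.restrict (Ioo 0 1)

/-- `tr(½ ∇² λ) = ν - μ` in `ℝ^d`, for a positive semidefinite matrix-valued measure `λ`
supported in `X`, in the sense of distributions. -/
structure SolvesStatic (X : Set (Space d)) (μ ν : Measure (Space d)) (lam : MatMeasure d) :
    Prop where
  psd : IsPSDValued lam
  support_subset : (totalVar lam).support ⊆ X
  weak_eq : ∀ φ : Space d → ℝ, ContDiff ℝ 2 φ → HasCompactSupport φ →
    matIntegral (fun x => (1 / 2 : ℝ) • hessian φ x) lam = (∫ x, φ x ∂ν) - ∫ x, φ x ∂μ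

/-- The families `ϱ_t` and `λ_t`, `t ∈ (0, 1)`, are the disintegrations with respect to time of a
finite positive measure `ϱ = ϱ_t ⊗ 𝓛¹` and of a positive semidefinite matrix-valued measure
`λ = λ_t ⊗ 𝓛¹` on `(0, 1) × ℝ^d`, and `∂_t ϱ = tr(½ ∇² λ)` in the sense of distributions. All
conditions are insensitive to changes of the families on a null set of times. -/
structure SolvesFPE (rho : ℝ → Measure (Space d)) (lam : ℝ → MatMeasure d) : Prop where
  rho_measurable : ∀ B, MeasurableSet B → AEMeasurable (fun t => rho t B) timeMeasure
  rho_finite : ∫⁻ t, rho t univ ∂timeMeasure < ∞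
  lam_measurable : ∀ B, MeasurableSet B → ∀ i j,
    AEMeasurable (fun t => lam t B i j) timeMeasure
  lam_psd : ∀ᵐ t ∂timeMeasure, IsPSDValued (lam t)
  lam_locallyFinite : ∀ K : Set (Space d), IsCompact K →
    ∫⁻ t, totalVar (lam t) K ∂timeMeasure < ∞
  weak_eq : ∀ φ : ℝ × Space d → ℝ, ContDiff ℝ 2 φ → HasCompactSupport φ →
    tsupport φ ⊆ Ioo 0 1 ×ˢ univ →
    ∫ t, (∫ x, deriv (fun s => φ (s, x)) t ∂rho t) ∂timeMeasure =
      -∫ t, matIntegral (fun x => (1 / 2 : ℝ) • hessian (fun y => φ (t, y)) x) (lam t)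
        ∂timeMeasure

/-- `ϱ_0 = μ` and `ϱ_1 = ν`: the endpoint values of the narrowly continuous representative on
`[0, 1]` of the family `ϱ_t`, `t ∈ (0, 1)`. -/
def HasEndpoints (rho : ℝ → Measure (Space d)) (μ ν : Measure (Space d)) : Prop :=
  ∃ rho' : ℝ → Measure (Space d),
    (∀ t ∈ Icc (0 : ℝ) 1, IsFiniteMeasure (rho' t)) ∧
    (∀ᵐ t ∂timeMeasure, rho' t = rho t) ∧
    (∀ ψ : Space d →ᵇ ℝ, ContinuousOn (fun t => ∫ x, ψ x ∂rho' t) (Icc 0 1)) ∧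
    rho' 0 = μ ∧ rho' 1 = ν

/-- The competitors of the dynamic problem. -/
structure IsDynamicCompetitor (X : Set (Space d)) (μ ν : Measure (Space d))
    (rho : ℝ → Measure (Space d)) (lam : ℝ → MatMeasure d) : Prop where
  solves : SolvesFPE rho lam
  rho_support : ∀ᵐ t ∂timeMeasure, (rho t).support ⊆ X
  lam_support : ∀ᵐ t ∂timeMeasure, (totalVar (lam t)).support ⊆ X
  endpoints : HasEndpoints rho μ ν

/-- The value `F(μ, ν)` of the dynamic problem; it is `+∞` if there is no competitor. -/
def dynamicValue (f : Mat d → ℝ≥0∞) (X : Set (Space d)) (μ ν : Measure (Space d)) : ℝ≥0∞ :=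
  ⨅ (rho : ℝ → Measure (Space d)) (lam : ℝ → MatMeasure d)
    (_ : IsDynamicCompetitor X μ ν rho lam), ∫⁻ t, cost f X (lam t) ∂timeMeasure

/-- The value of the problem without time; it is `+∞` if there is no competitor. -/
def staticValue (f : Mat d → ℝ≥0∞) (X : Set (Space d)) (μ ν : Measure (Space d)) : ℝ≥0∞ :=
  ⨅ (lam : MatMeasure d) (_ : SolvesStatic X μ ν lam), cost f X lam

end FokkerPlanckOT

end

noncomputable section

namespace FokkerPlanckOT

variable {d : ℕ}

/-! Time can be averaged out, so each competitor of one problem yields a competitor of the other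
that costs no more.

From dynamic to static, take `Λ = ∫ λ_t dt`. Testing the Fokker–Planck equation with `η(t) ψ(x)`
shows that `t ↦ ∫ ψ dϱ_t` has weak derivative `∫ ½∇²ψ : dλ_t`; integrating over `(0, 1)` gives the
static equation for `Λ` (`matIntegral_average`, `sub_eq_integral_of_weak_deriv`). The cost does not
grow, by a Jensen inequality (`cost_le_lintegral_cost`): Hahn–Banach writes `f` as a countable
supremum of linear functionals (`IsCost.exists_seq_eq_iSup`), and these commute with the average.

From static to dynamic, keep `λ` constant in time and let `ϱ_t` be the linear interpolation of `μ`
and `ν` (`SolvesStatic.isDynamicCompetitor`).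

The family `λ_t` is only measurable in `t` set by set, so the densities need not be jointly
measurable and Fubini is not at hand. Statements about `Λ` are derived from the values `λ_t(B)`,
with domination by the trace, which is linear and controls a positive semidefinite matrix. -/

/-! ### Positive semidefinite matrices -/

theorem frob_eq_sum (A B : Mat d) : frob A B = ∑ i, ∑ j, A i j * B i j := by
  simp only [frob, Matrix.trace, Matrix.diag, Matrix.mul_apply, Matrix.transpose_apply]
  exact Finset.sum_comm

theorem sq_entry_le_of_posSemidef {A : Mat d} (hA : A.PosSemidef) (i j : Fin d) :
    A i j ^ 2 ≤ A i i * A j j := by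
  have h := (hA.submatrix ![i, j]).det_nonneg
  have hs : A j i = A i j := by simpa using hA.isHermitian.apply i j
  simp only [Matrix.det_fin_two, Matrix.submatrix_apply, Matrix.cons_val_zero,
    Matrix.cons_val_one, hs] at h
  nlinarith

/-- Sum `A i j ^ 2 ≤ A i i * A j j` over all entries: the right side is the square of the trace. -/
theorem frobNorm_le_trace {A : Mat d} (hA : A.PosSemidef) : frobNorm A ≤ A.trace := by
  refine Real.sqrt_le_iff.2 ⟨hA.trace_nonneg, ?_⟩
  rw [frob_eq_sum, sq, Matrix.trace, Finset.sum_mul_sum]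
  refine Finset.sum_le_sum fun i _ => Finset.sum_le_sum fun j _ => ?_
  simpa [sq] using sq_entry_le_of_posSemidef hA i j

theorem abs_entry_le_frobNorm (A : Mat d) (i j : Fin d) : |A i j| ≤ frobNorm A := by
  rw [← norm_vecHom]
  exact PiLp.norm_apply_le (vecHom d A) (i, j)

theorem abs_entry_le_trace {A : Mat d} (hA : A.PosSemidef) (i j : Fin d) :
    |A i j| ≤ A.trace :=
  (abs_entry_le_frobNorm A i j).trans (frobNorm_le_trace hA)

/-! ### Total variation and polar density -/

@[simp]
theorem entry_apply (lam : MatMeasure d) (i j : Fin d) (B : Set (Space d)) :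
    entry lam i j B = lam B i j := rfl

theorem ofReal_frobNorm_le_totalVar (lam : MatMeasure d) (B : Set (Space d)) :
    ENNReal.ofReal (frobNorm (lam B)) ≤ totalVar lam B := by
  rw [← norm_vecHom, ofReal_norm]
  exact VectorMeasure.enorm_measure_le_variation (lam.mapRange (vecHom d) continuous_vecHom) B

theorem totalVar_le_of_forall {lam : MatMeasure d} {m : Measure (Space d)}
    (h : ∀ B, MeasurableSet B → ENNReal.ofReal (frobNorm (lam B)) ≤ m B) : totalVar lam ≤ m := by
  refine VectorMeasure.variation_le_of_forall_enorm_le fun E hE => ?_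
  have := h E hE
  rwa [← norm_vecHom, ofReal_norm] at this

theorem absolutelyContinuous_entry (lam : MatMeasure d) (i j : Fin d) :
    entry lam i j ≪ᵥ (totalVar lam).toENNRealVectorMeasure := by
  refine VectorMeasure.AbsolutelyContinuous.mk fun B hB h0 => ?_
  rw [Measure.toENNRealVectorMeasure_apply_measurable hB] at h0
  have h1 := (ofReal_frobNorm_le_totalVar lam B).trans h0.le
  have h2 : frobNorm (lam B) ≤ 0 := by simpa using h1
  exact abs_nonpos_iff.1 ((abs_entry_le_frobNorm (lam B) i j).trans h2)

theorem trace_mono {lam : MatMeasure d} (h : IsPSDValued lam) {B B' : Set (Space d)}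
    (hB : MeasurableSet B) (hB' : MeasurableSet B') (hs : B ⊆ B') :
    (lam B).trace ≤ (lam B').trace := by
  have h1 := VectorMeasure.of_add_of_sdiff (v := lam) hB hB' hs
  rw [← h1, Matrix.trace_add]
  linarith [(h _ (hB'.diff hB)).trace_nonneg]

/-- The trace of a matrix-valued measure, as a signed measure. -/
def traceMeasure (lam : MatMeasure d) : SignedMeasure (Space d) :=
  lam.mapRange (Matrix.traceAddMonoidHom (Fin d) ℝ) (continuous_id.matrix_trace)

@[simp]
theorem traceMeasure_apply (lam : MatMeasure d) (B : Set (Space d)) :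
    traceMeasure lam B = (lam B).trace := rfl

/-- The set function `E ↦ tr λ(E)` is itself a positive measure dominating the Frobenius norm of
`λ(E)`, and the variation is the least measure that does so. -/
theorem totalVar_le_trace {lam : MatMeasure d} (h : IsPSDValued lam) {B : Set (Space d)}
    (hB : MeasurableSet B) : totalVar lam B ≤ ENNReal.ofReal (lam B).trace := by
  have h0 : 0 ≤[univ] traceMeasure lam :=
    VectorMeasure.le_restrict_univ_iff_le .. |>.2 fun B hB => by
      simpa using (h B hB).trace_nonneg
  have h1 : totalVar lam ≤ (traceMeasure lam).toMeasureOfZeroLE univ MeasurableSet.univ h0 := by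
    refine totalVar_le_of_forall fun E hE => ?_
    rw [SignedMeasure.toMeasureOfZeroLE_apply _ h0 MeasurableSet.univ hE,
      ← ENNReal.ofReal_eq_coe_nnreal]
    simpa using ENNReal.ofReal_le_ofReal (frobNorm_le_trace (h E hE))
  refine (h1 B).trans ?_
  rw [SignedMeasure.toMeasureOfZeroLE_apply _ h0 MeasurableSet.univ hB,
    ← ENNReal.ofReal_eq_coe_nnreal]
  simp

theorem isFiniteMeasure_totalVar {lam : MatMeasure d} (h : IsPSDValued lam) :
    IsFiniteMeasure (totalVar lam) :=
  ⟨(totalVar_le_trace h MeasurableSet.univ).trans_lt ENNReal.ofReal_lt_top⟩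

theorem measurable_polarDensity (lam : MatMeasure d) (i j : Fin d) :
    Measurable fun x => polarDensity lam x i j :=
  SignedMeasure.measurable_rnDeriv _ _

theorem integrable_polarDensity (lam : MatMeasure d) (i j : Fin d) :
    Integrable (fun x => polarDensity lam x i j) (totalVar lam) :=
  SignedMeasure.integrable_rnDeriv _ _

theorem setIntegral_polarDensity {lam : MatMeasure d} (h : IsPSDValued lam) (i j : Fin d)
    {B : Set (Space d)} (hB : MeasurableSet B) :
    ∫ x in B, polarDensity lam x i j ∂totalVar lam = lam B i j := by
  have := isFiniteMeasure_totalVar h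
  have h1 := SignedMeasure.withDensityᵥ_rnDeriv_eq (entry lam i j) (totalVar lam)
    (absolutelyContinuous_entry lam i j)
  rw [← entry_apply, ← h1, withDensityᵥ_apply (SignedMeasure.integrable_rnDeriv _ _) hB]
  rfl

theorem measurable_frob_polarDensity (lam : MatMeasure d) (C : Mat d) :
    Measurable fun x => frob C (polarDensity lam x) := by
  simp only [frob_eq_sum]
  exact Finset.measurable_sum _ fun i _ => Finset.measurable_sum _ fun j _ =>
    (measurable_polarDensity lam i j).const_mul _

theorem integrable_frob_polarDensity (lam : MatMeasure d) (C : Mat d) :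
    Integrable (fun x => frob C (polarDensity lam x)) (totalVar lam) := by
  simp only [frob_eq_sum]
  exact integrable_finsetSum _ fun i _ => integrable_finsetSum _ fun j _ =>
    (integrable_polarDensity lam i j).const_mul _

theorem setIntegral_frob_polarDensity {lam : MatMeasure d} (h : IsPSDValued lam) (C : Mat d)
    {B : Set (Space d)} (hB : MeasurableSet B) :
    ∫ x in B, frob C (polarDensity lam x) ∂totalVar lam = frob C (lam B) := by
  simp only [frob_eq_sum]
  refine (integral_finsetSum _ fun i _ => integrable_finsetSum _ fun j _ =>
    ((integrable_polarDensity lam i j).const_mul _).integrableOn).trans ?_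
  refine Finset.sum_congr rfl fun i _ => ?_
  refine (integral_finsetSum _ fun j _ =>
    ((integrable_polarDensity lam i j).const_mul _).integrableOn).trans ?_
  refine Finset.sum_congr rfl fun j _ => ?_
  rw [integral_const_mul, setIntegral_polarDensity h i j hB]

/-- Cutting along the sign of the density turns the integral into two entries of `λ`, each bounded
by the total trace; hence the factor 2. The bound is in terms of a quantity that is integrable in
time. -/
theorem integral_abs_polarDensity_le {lam : MatMeasure d} (h : IsPSDValued lam) (i j : Fin d) :
    ∫ x, |polarDensity lam x i j| ∂totalVar lam ≤ 2 * (lam univ).trace := by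
  have hm : MeasurableSet {x | 0 ≤ polarDensity lam x i j} :=
    measurableSet_le measurable_const (measurable_polarDensity lam i j)
  rw [← integral_add_compl hm (integrable_polarDensity lam i j).abs]
  have e1 : ∫ x in {x | 0 ≤ polarDensity lam x i j}, |polarDensity lam x i j| ∂totalVar lam =
      lam {x | 0 ≤ polarDensity lam x i j} i j := by
    rw [← setIntegral_polarDensity h i j hm]
    exact setIntegral_congr_fun hm fun x hx => abs_of_nonneg hx
  have e2 : ∫ x in {x | 0 ≤ polarDensity lam x i j}ᶜ, |polarDensity lam x i j| ∂totalVar lam =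
      - lam {x | 0 ≤ polarDensity lam x i j}ᶜ i j := by
    rw [← setIntegral_polarDensity h i j hm.compl, ← integral_neg]
    exact setIntegral_congr_fun hm.compl fun x hx => abs_of_nonpos (le_of_not_ge hx)
  rw [e1, e2]
  have a1 := (le_abs_self _).trans ((abs_entry_le_trace (h _ hm) i j).trans
    (trace_mono h hm MeasurableSet.univ (subset_univ _)))
  have a2 := (neg_le_abs _).trans ((abs_entry_le_trace (h _ hm.compl) i j).trans
    (trace_mono h hm.compl MeasurableSet.univ (subset_univ _)))
  linarith

/-! ### The cost as a supremum of linear functionals -/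

namespace IsCost

variable {f : Mat d → ℝ≥0∞}

/-- The epigraph of `f` is a closed convex cone, so a hyperplane separates it from the point `(A₀,
s₀)` below the graph. -/
theorem exists_frob_le_of_lt (hf : IsCost f) {A₀ : Mat d} {s₀ : ℝ} (hs₀ : 0 ≤ s₀)
    (h : ENNReal.ofReal s₀ < f A₀) :
    ∃ C : Mat d, (∀ A, ENNReal.ofReal (frob C A) ≤ f A) ∧ s₀ < frob C A₀ := by
  -- The condition `0 ≤ p.2` is needed because `ENNReal.ofReal` sends negative heights to `0`.
  let K : Set ((Fin d → Fin d → ℝ) × ℝ) :=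
    {p | f (Matrix.of p.1) ≤ ENNReal.ofReal p.2 ∧ 0 ≤ p.2}
  have hsmul : ∀ p ∈ K, ∀ t : ℝ, 0 ≤ t → t • p ∈ K := by
    intro p hp t ht
    refine ⟨?_, mul_nonneg ht hp.2⟩
    have h1 := hf.homogeneous t.toNNReal (Matrix.of p.1)
    rw [Real.coe_toNNReal t ht] at h1
    calc f (Matrix.of (t • p).1) = t.toNNReal * f (Matrix.of p.1) := h1
      _ ≤ ENNReal.ofReal t * ENNReal.ofReal p.2 := mul_le_mul_right hp.1 _
      _ = ENNReal.ofReal (t • p).2 := (ENNReal.ofReal_mul ht).symm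
  have hadd : ∀ p ∈ K, ∀ q ∈ K, p + q ∈ K := by
    intro p hp q hq
    refine ⟨?_, add_nonneg hp.2 hq.2⟩
    calc f (Matrix.of (p + q).1) ≤ f (Matrix.of p.1) + f (Matrix.of q.1) := hf.subadditive _ _
      _ ≤ ENNReal.ofReal p.2 + ENNReal.ofReal q.2 := add_le_add hp.1 hq.1
      _ = ENNReal.ofReal (p + q).2 := (ENNReal.ofReal_add hp.2 hq.2).symm
  have hconv : Convex ℝ K := fun p hp q hq a b ha hb _ =>
    hadd _ (hsmul p hp a ha) _ (hsmul q hq b hb)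
  have hclosed : IsClosed K := by
    have h1 := hf.lowerSemicontinuous.isClosed_epigraph
    have h2 : Continuous fun p : (Fin d → Fin d → ℝ) × ℝ =>
        ((Matrix.of p.1 : Mat d), ENNReal.ofReal p.2) :=
      (continuous_fst : Continuous fun p : (Fin d → Fin d → ℝ) × ℝ => p.1).prodMk
        (ENNReal.continuous_ofReal.comp continuous_snd)
    exact (h1.preimage h2).inter (isClosed_le continuous_const continuous_snd)
  have hnot : ((fun i j => A₀ i j, s₀) : (Fin d → Fin d → ℝ) × ℝ) ∉ K := fun hK =>
    (hK.1.trans_lt h).false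
  obtain ⟨g, u, hgK, hgu⟩ := geometric_hahn_banach_closed_point hconv hclosed hnot
  have hf0 : f 0 = 0 := by simpa using hf.homogeneous 0 0
  have h0K : ((0, 0) : (Fin d → Fin d → ℝ) × ℝ) ∈ K :=
    ⟨by simpa using hf0.le, le_rfl⟩
  have h1K : ((0, 1) : (Fin d → Fin d → ℝ) × ℝ) ∈ K :=
    ⟨by simp [hf0], zero_le_one⟩
  have hu : 0 < u := (map_zero g).symm.trans_lt (hgK _ h0K)
  -- On a cone a linear functional bounded above is nonpositive: a positive value could be rescaled
  -- to equal `u`.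
  have hg : ∀ p ∈ K, g p ≤ 0 := by
    intro p hp
    by_contra! hpos
    have := hgK _ (hsmul p hp (u / g p) (by positivity))
    rw [map_smul, smul_eq_mul, div_mul_cancel₀ _ hpos.ne'] at this
    exact this.false
  let G : Mat d := Matrix.of fun i j => g (Pi.single i (Pi.single j 1), 0)
  have hG : ∀ (A : Mat d) (s : ℝ), g (fun i j => A i j, s) = frob G A + s * g (0, 1) := by
    intro A s
    have e : ((fun i j => A i j, s) : (Fin d → Fin d → ℝ) × ℝ) =
        (∑ i, ∑ j, A i j • ((Pi.single i (Pi.single j 1), 0) : (Fin d → Fin d → ℝ) × ℝ)) +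
          s • ((0, 1) : (Fin d → Fin d → ℝ) × ℝ) := by
      refine Prod.ext ?_ ?_
      · funext i j
        simp [Prod.fst_sum, Finset.sum_apply, Pi.single_apply, apply_ite]
      · simp [Prod.snd_sum]
    rw [e, map_add, map_sum, map_smul, smul_eq_mul, frob_eq_sum]
    congr 1
    refine Finset.sum_congr rfl fun i _ => ?_
    rw [map_sum]
    refine Finset.sum_congr rfl fun j _ => ?_
    rw [map_smul, smul_eq_mul, mul_comm]
    rfl
  have hdom : ∀ A, f A ≠ ∞ → frob G A + (f A).toReal * g (0, 1) ≤ 0 := by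
    intro A hA
    rw [← hG]
    exact hg _ ⟨by rw [ENNReal.ofReal_toReal hA]; exact le_rfl, ENNReal.toReal_nonneg⟩
  have hsmulC : ∀ (c : ℝ) (A : Mat d), frob (c • G) A = c * frob G A := by
    intro c A
    simp [frob]
  have hA₀ : 0 < frob G A₀ + s₀ * g (0, 1) := by
    rw [← hG]; exact hu.trans hgu
  -- If the hyperplane is not vertical, normalise its slope. If it is vertical, `G` is nonpositive
  -- on the domain of `f` and positive at `A₀`, so a large enough multiple of `G` works.
  rcases (hg _ h1K).lt_or_eq with ha | ha
  · refine ⟨(-g (0, 1))⁻¹ • G, fun A => ?_, ?_⟩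
    · rcases eq_or_ne (f A) ∞ with hA | hA
      · simp [hA]
      · refine ENNReal.ofReal_le_of_le_toReal ?_
        rw [hsmulC, inv_mul_le_iff₀ (by linarith)]
        linarith [hdom A hA]
    · rw [hsmulC, lt_inv_mul_iff₀ (by linarith)]
      linarith
  · rw [ha, mul_zero, add_zero] at hA₀
    refine ⟨((s₀ + 1) / frob G A₀) • G, fun A => ?_, ?_⟩
    · rcases eq_or_ne (f A) ∞ with hA | hA
      · simp [hA]
      · have h1 := hdom A hA
        rw [ha, mul_zero, add_zero] at h1
        rw [hsmulC, ENNReal.ofReal_of_nonpos]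
        · exact zero_le
        · exact mul_nonpos_of_nonneg_of_nonpos (by positivity) h1
    · rw [hsmulC, div_mul_cancel₀ _ hA₀.ne']
      linarith

/-- The strict hypographs of the linear minorants are open, so by the Lindelöf property countably
many of them have the same union. The zero functional is added so that the family can be indexed by
`ℕ`. -/
theorem exists_seq_eq_iSup (hf : IsCost f) :
    ∃ C : ℕ → Mat d, ∀ A, f A = ⨆ n, ENNReal.ofReal (frob (C n) A) := by
  let S : Set (Mat d) := {C | ∀ A, ENNReal.ofReal (frob C A) ≤ f A}
  let U : S → Set ((Fin d → Fin d → ℝ) × ℝ) := fun C => {p | p.2 < frob C.1 (Matrix.of p.1)}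
  have hU : ∀ C, IsOpen (U C) := by
    intro C
    refine isOpen_lt continuous_snd ?_
    simp only [frob_eq_sum, Matrix.of_apply]
    fun_prop
  obtain ⟨T, hT, hTU⟩ := TopologicalSpace.isOpen_iUnion_countable U hU
  have h0 : (0 : Mat d) ∈ S := fun A => by simp [frob]
  obtain ⟨c, hc⟩ := (hT.insert ⟨0, h0⟩).exists_eq_range (insert_nonempty _ _)
  refine ⟨fun n => (c n).1, fun A => le_antisymm ?_ (iSup_le fun n => (c n).2 A)⟩
  refine le_of_forall_lt fun r hr => ?_
  obtain ⟨r', hr', hr''⟩ := exists_between hr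
  have hr't : r' ≠ ∞ := hr''.ne_top
  obtain ⟨C, hC, hCA⟩ := hf.exists_frob_le_of_lt (A₀ := A) (ENNReal.toReal_nonneg (a := r'))
    (by rwa [ENNReal.ofReal_toReal hr't])
  have hmem : ((fun i j => A i j, r'.toReal) : (Fin d → Fin d → ℝ) × ℝ) ∈ ⋃ C ∈ T, U C := by
    rw [hTU]
    exact mem_iUnion.2 ⟨⟨C, hC⟩, hCA⟩
  obtain ⟨D, hDT, hD⟩ := mem_iUnion₂.1 hmem
  obtain ⟨n, rfl⟩ : D ∈ range c := hc ▸ mem_insert_of_mem _ hDT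
  refine hr'.trans_le (le_iSup_of_le n ?_)
  rw [← ENNReal.ofReal_toReal hr't]
  exact ENNReal.ofReal_le_ofReal hD.le

end IsCost

/-! ### Jensen inequality for the cost -/

theorem ofReal_integral_le_lintegral {α : Type*} [MeasurableSpace α] {m : Measure α} (g : α → ℝ) :
    ENNReal.ofReal (∫ x, g x ∂m) ≤ ∫⁻ x, ENNReal.ofReal (g x) ∂m := by
  by_cases hg : Integrable g m
  · rw [integral_eq_lintegral_pos_part_sub_lintegral_neg_part hg]
    refine (ENNReal.ofReal_le_ofReal (sub_le_self _ ENNReal.toReal_nonneg)).trans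
      ENNReal.ofReal_toReal_le
  · simp [integral_undef hg]

/-- Replace `f` by the maximum of finitely many linear functionals. Where a single one is maximal
and nonnegative, its integral is `C n : Λ(B)`, which is an average over `t`; elsewhere cut the set.
Monotone convergence recovers `f`. -/
theorem cost_le_lintegral_cost {f : Mat d → ℝ≥0∞} (hf : IsCost f) {X : Set (Space d)}
    (hX : MeasurableSet X) {τ : Measure ℝ} {lam : ℝ → MatMeasure d} {Lam : MatMeasure d}
    (hpsd : ∀ᵐ t ∂τ, IsPSDValued (lam t)) (hPSD : IsPSDValued Lam)
    (hLam : ∀ B, MeasurableSet B → ∀ C, frob C (Lam B) = ∫ t, frob C (lam t B) ∂τ) :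
    cost f X Lam ≤ ∫⁻ t, cost f X (lam t) ∂τ := by
  obtain ⟨C, hC⟩ := hf.exists_seq_eq_iSup
  have hmeas : ∀ n, Measurable fun x => ENNReal.ofReal (frob (C n) (polarDensity Lam x)) :=
    fun n => (measurable_frob_polarDensity Lam (C n)).ennreal_ofReal
  let F : ℕ → Space d → ℝ≥0∞ := fun N x =>
    partialSups (fun n => ENNReal.ofReal (frob (C n) (polarDensity Lam x))) N
  have hF0 : ∀ x, F 0 x = ENNReal.ofReal (frob (C 0) (polarDensity Lam x)) := fun x => by simp [F]
  have hFs : ∀ N x, F (N + 1) x =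
      max (F N x) (ENNReal.ofReal (frob (C (N + 1)) (polarDensity Lam x))) := fun N x =>
    partialSups_add_one _ _
  have hFm : ∀ N, Measurable (F N) := by
    intro N
    induction N with
    | zero => exact (funext hF0 : F 0 = _) ▸ hmeas 0
    | succ N ih => exact (funext (hFs N) : F (N + 1) = _) ▸ ih.max (hmeas _)
  have hpos : ∀ n (B : Set (Space d)), MeasurableSet B →
      ∫⁻ x in B, ENNReal.ofReal (frob (C n) (polarDensity Lam x)) ∂totalVar Lam ≤
        ∫⁻ t, ∫⁻ x in B, f (polarDensity (lam t) x) ∂totalVar (lam t) ∂τ := by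
    intro n B hB
    let P : Set (Space d) := {x | 0 ≤ frob (C n) (polarDensity Lam x)}
    have hP : MeasurableSet P := measurableSet_le measurable_const (measurable_frob_polarDensity _ _)
    have h1 : ∫⁻ x in B, ENNReal.ofReal (frob (C n) (polarDensity Lam x)) ∂totalVar Lam =
        ∫⁻ x in B ∩ P, ENNReal.ofReal (frob (C n) (polarDensity Lam x)) ∂totalVar Lam := by
      rw [← lintegral_inter_add_sdiff _ B hP,
        setLIntegral_congr_fun (g := fun _ => 0) (hB.diff hP), lintegral_zero, add_zero]
      exact fun x hx => ENNReal.ofReal_of_nonpos (le_of_not_ge hx.2)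
    have h2 : ∫⁻ x in B ∩ P, ENNReal.ofReal (frob (C n) (polarDensity Lam x)) ∂totalVar Lam =
        ENNReal.ofReal (frob (C n) (Lam (B ∩ P))) := by
      rw [← setIntegral_frob_polarDensity hPSD _ (hB.inter hP), ofReal_integral_eq_lintegral_ofReal
        (integrable_frob_polarDensity _ _).integrableOn]
      exact (ae_restrict_iff' (hB.inter hP)).2 (ae_of_all _ fun x hx => hx.2)
    rw [h1, h2, hLam _ (hB.inter hP)]
    refine (ofReal_integral_le_lintegral _).trans (lintegral_mono_ae ?_)
    filter_upwards [hpsd] with t ht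
    rw [← setIntegral_frob_polarDensity ht _ (hB.inter hP)]
    refine (ofReal_integral_le_lintegral _).trans ?_
    refine (lintegral_mono fun x => ?_).trans (lintegral_mono_set inter_subset_left)
    rw [hC]
    exact le_iSup (fun n => ENNReal.ofReal (frob (C n) (polarDensity (lam t) x))) n
  -- The claim is made for every `B` so that the induction can be applied to the pieces `B ∩ Q`.
  have hstep : ∀ N (B : Set (Space d)), MeasurableSet B →
      ∫⁻ x in B, F N x ∂totalVar Lam ≤
        ∫⁻ t, ∫⁻ x in B, f (polarDensity (lam t) x) ∂totalVar (lam t) ∂τ := by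
    intro N
    induction N with
    | zero =>
      intro B hB
      simpa only [hF0] using hpos 0 B hB
    | succ N ih =>
      intro B hB
      let Q : Set (Space d) :=
        {x | ENNReal.ofReal (frob (C (N + 1)) (polarDensity Lam x)) ≤ F N x}
      have hQ : MeasurableSet Q := measurableSet_le (hmeas _) (hFm N)
      have e1 : ∫⁻ x in B ∩ Q, F (N + 1) x ∂totalVar Lam =
          ∫⁻ x in B ∩ Q, F N x ∂totalVar Lam :=
        setLIntegral_congr_fun (hB.inter hQ) fun x hx => (hFs N x).trans (max_eq_left hx.2)
      have e2 : ∫⁻ x in B \ Q, F (N + 1) x ∂totalVar Lam =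
          ∫⁻ x in B \ Q, ENNReal.ofReal (frob (C (N + 1)) (polarDensity Lam x)) ∂totalVar Lam :=
        setLIntegral_congr_fun (hB.diff hQ) fun x hx =>
          (hFs N x).trans (max_eq_right (le_of_not_ge hx.2))
      rw [← lintegral_inter_add_sdiff _ B hQ, e1, e2]
      refine (add_le_add (ih _ (hB.inter hQ)) (hpos _ _ (hB.diff hQ))).trans ?_
      -- Superadditivity of the lower integral needs no measurability in `t`.
      refine (le_lintegral_add _ _).trans (lintegral_mono fun t => ?_)
      exact (lintegral_inter_add_sdiff _ B hQ).le
  have hsup : cost f X Lam = ⨆ N, ∫⁻ x in X, F N x ∂totalVar Lam := by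
    rw [← lintegral_iSup hFm fun N M hNM x => (partialSups _).monotone hNM]
    refine lintegral_congr fun x => ?_
    rw [hC]
    exact (iSup_partialSups_eq _).symm
  rw [hsup]
  exact iSup_le fun N => hstep N X hX

/-! ### Averaging matrix-valued measures over time -/

section Average

variable {τ : Measure ℝ} {lam : ℝ → MatMeasure d}

theorem aemeasurable_trace
    (hm : ∀ B, MeasurableSet B → ∀ i j, AEMeasurable (fun t => lam t B i j) τ)
    {B : Set (Space d)} (hB : MeasurableSet B) : AEMeasurable (fun t => (lam t B).trace) τ :=
  Finset.aemeasurable_fun_sum _ fun i _ => hm B hB i i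

theorem integrable_trace
    (hm : ∀ B, MeasurableSet B → ∀ i j, AEMeasurable (fun t => lam t B i j) τ)
    (hpsd : ∀ᵐ t ∂τ, IsPSDValued (lam t))
    (hint : Integrable (fun t => (lam t univ).trace) τ)
    {B : Set (Space d)} (hB : MeasurableSet B) : Integrable (fun t => (lam t B).trace) τ := by
  refine hint.mono' (aemeasurable_trace hm hB).aestronglyMeasurable ?_
  filter_upwards [hpsd] with t ht
  rw [Real.norm_of_nonneg (ht B hB).trace_nonneg]
  exact trace_mono ht hB MeasurableSet.univ (subset_univ _)

theorem integrable_entry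
    (hm : ∀ B, MeasurableSet B → ∀ i j, AEMeasurable (fun t => lam t B i j) τ)
    (hpsd : ∀ᵐ t ∂τ, IsPSDValued (lam t))
    (hint : Integrable (fun t => (lam t univ).trace) τ)
    {B : Set (Space d)} (hB : MeasurableSet B) (i j : Fin d) :
    Integrable (fun t => lam t B i j) τ := by
  refine (integrable_trace hm hpsd hint hB).mono' (hm B hB i j).aestronglyMeasurable ?_
  filter_upwards [hpsd] with t ht
  exact abs_entry_le_trace (ht B hB) i j

/-- The average `∫ λ_t dt` of a family of positive semidefinite matrix-valued measures. -/
theorem exists_average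
    (hm : ∀ B, MeasurableSet B → ∀ i j, AEMeasurable (fun t => lam t B i j) τ)
    (hpsd : ∀ᵐ t ∂τ, IsPSDValued (lam t))
    (hint : Integrable (fun t => (lam t univ).trace) τ) :
    ∃ Lam : MatMeasure d, ∀ B, MeasurableSet B → ∀ i j, Lam B i j = ∫ t, lam t B i j ∂τ := by
  classical
  refine ⟨⟨fun B => Matrix.of fun i j => if MeasurableSet B then ∫ t, lam t B i j ∂τ else 0,
    ?_, ?_, ?_⟩, fun B hB i j => if_pos hB⟩
  · ext i j
    simp
  · intro B hB
    ext i j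
    simp [hB]
  · intro B hB hdisj
    refine Pi.hasSum.2 fun i => Pi.hasSum.2 fun j => ?_
    simp only [Matrix.of_apply, hB, MeasurableSet.iUnion hB, if_true]
    -- Countable additivity passes through the time integral by dominated convergence: the traces of
    -- the pieces dominate their entries and sum to the trace of the union.
    have htr : ∀ t, HasSum (fun n => (lam t (B n)).trace) (lam t (⋃ n, B n)).trace := fun t =>
      (traceMeasure (lam t)).m_iUnion hB hdisj
    have hent : ∀ t, HasSum (fun n => lam t (B n) i j) (lam t (⋃ n, B n) i j) := fun t =>
      (entry (lam t) i j).m_iUnion hB hdisj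
    refine hasSum_integral_of_dominated_convergence (fun n t => (lam t (B n)).trace)
      (fun n => (hm _ (hB n) i j).aestronglyMeasurable) (fun n => ?_)
      (ae_of_all _ fun t => (htr t).summable) ?_ (ae_of_all _ hent)
    · filter_upwards [hpsd] with t ht
      exact abs_entry_le_trace (ht _ (hB n)) i j
    · simp only [(htr _).tsum_eq]
      exact integrable_trace hm hpsd hint (MeasurableSet.iUnion hB)

variable {Lam : MatMeasure d}

theorem frob_average
    (hm : ∀ B, MeasurableSet B → ∀ i j, AEMeasurable (fun t => lam t B i j) τ)
    (hpsd : ∀ᵐ t ∂τ, IsPSDValued (lam t))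
    (hint : Integrable (fun t => (lam t univ).trace) τ)
    (hLam : ∀ B, MeasurableSet B → ∀ i j, Lam B i j = ∫ t, lam t B i j ∂τ)
    {B : Set (Space d)} (hB : MeasurableSet B) (C : Mat d) :
    frob C (Lam B) = ∫ t, frob C (lam t B) ∂τ := by
  have h := fun i j => (integrable_entry hm hpsd hint hB i j).const_mul (C i j)
  simp only [frob_eq_sum]
  refine Eq.symm ((integral_finsetSum _ fun i _ => integrable_finsetSum _ fun j _ => h i j).trans ?_)
  refine Finset.sum_congr rfl fun i _ => ?_
  refine (integral_finsetSum _ fun j _ => h i j).trans ?_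
  refine Finset.sum_congr rfl fun j _ => ?_
  rw [integral_const_mul, hLam B hB]

theorem isPSDValued_average
    (hm : ∀ B, MeasurableSet B → ∀ i j, AEMeasurable (fun t => lam t B i j) τ)
    (hpsd : ∀ᵐ t ∂τ, IsPSDValued (lam t))
    (hint : Integrable (fun t => (lam t univ).trace) τ)
    (hLam : ∀ B, MeasurableSet B → ∀ i j, Lam B i j = ∫ t, lam t B i j ∂τ) :
    IsPSDValued Lam := by
  intro B hB
  -- Positivity is a family of linear inequalities, since the quadratic form is pairing with `v vᵀ`.
  have hquad : ∀ (v : Fin d → ℝ) (A : Mat d), v ⬝ᵥ A.mulVec v = frob (Matrix.vecMulVec v v) A := by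
    intro v A
    simp only [frob_eq_sum, Matrix.vecMulVec_apply, dotProduct, Matrix.mulVec, Finset.mul_sum]
    exact Finset.sum_congr rfl fun i _ => Finset.sum_congr rfl fun j _ => by ring
  refine Matrix.PosSemidef.of_dotProduct_mulVec_nonneg ?_ fun v => ?_
  · ext i j
    rw [Matrix.conjTranspose_apply, star_trivial, hLam B hB, hLam B hB]
    refine integral_congr_ae ?_
    filter_upwards [hpsd] with t ht
    simpa using (ht B hB).isHermitian.apply i j
  · rw [star_trivial, hquad, frob_average hm hpsd hint hLam hB]
    refine integral_nonneg_of_ae ?_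
    filter_upwards [hpsd] with t ht
    have := (ht B hB).dotProduct_mulVec_nonneg v
    rwa [star_trivial, hquad] at this

theorem totalVar_average_eq_zero
    (hLam : ∀ B, MeasurableSet B → ∀ i j, Lam B i j = ∫ t, lam t B i j ∂τ)
    (hPSD : IsPSDValued Lam) {B : Set (Space d)} (hB : MeasurableSet B)
    (h0 : ∀ᵐ t ∂τ, totalVar (lam t) B = 0) : totalVar Lam B = 0 := by
  refine le_antisymm ((totalVar_le_trace hPSD hB).trans ?_) zero_le
  have h1 : ∀ i j, Lam B i j = 0 := by
    intro i j
    rw [hLam B hB]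
    refine integral_eq_zero_of_ae ?_
    filter_upwards [h0] with t ht
    have h2 := (ofReal_frobNorm_le_totalVar (lam t) B).trans ht.le
    exact abs_nonpos_iff.1 ((abs_entry_le_frobNorm _ i j).trans (by simpa using h2))
  simp [Matrix.trace, h1]

theorem integrable_mul_polarDensity (lam : MatMeasure d) (i j : Fin d) {g : Space d → ℝ}
    (hg : StronglyMeasurable g) {c : ℝ} (hc : ∀ x, ‖g x‖ ≤ c) :
    Integrable (fun x => g x * polarDensity lam x i j) (totalVar lam) :=
  (integrable_polarDensity lam i j).bdd_mul hg.aestronglyMeasurable (ae_of_all _ hc)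

theorem norm_integral_mul_polarDensity_le {lam : MatMeasure d} (h : IsPSDValued lam)
    (i j : Fin d) {g : Space d → ℝ} {c : ℝ} (hc : ∀ x, ‖g x‖ ≤ c) :
    ‖∫ x, g x * polarDensity lam x i j ∂totalVar lam‖ ≤ c * (2 * (lam univ).trace) := by
  have hc0 : 0 ≤ c := (norm_nonneg _).trans (hc 0)
  calc ‖∫ x, g x * polarDensity lam x i j ∂totalVar lam‖
      ≤ ∫ x, c * |polarDensity lam x i j| ∂totalVar lam := by
        refine norm_integral_le_of_norm_le ((integrable_polarDensity lam i j).abs.const_mul c)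
          (ae_of_all _ fun x => ?_)
        rw [norm_mul]
        exact mul_le_mul_of_nonneg_right (hc x) (norm_nonneg _)
    _ ≤ c * (2 * (lam univ).trace) := by
        rw [integral_const_mul]
        exact mul_le_mul_of_nonneg_left (integral_abs_polarDensity_le h i j) hc0

/-- For an indicator this is the defining property of the average; linearity does the rest. It
replaces Fubini, as both the measure and its density depend on `t`. -/
theorem integral_average_simpleFunc
    (hm : ∀ B, MeasurableSet B → ∀ i j, AEMeasurable (fun t => lam t B i j) τ)
    (hpsd : ∀ᵐ t ∂τ, IsPSDValued (lam t))
    (hint : Integrable (fun t => (lam t univ).trace) τ)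
    (hLam : ∀ B, MeasurableSet B → ∀ i j, Lam B i j = ∫ t, lam t B i j ∂τ)
    (i j : Fin d) (g : SimpleFunc (Space d) ℝ) :
    Integrable (fun t => ∫ x, g x * polarDensity (lam t) x i j ∂totalVar (lam t)) τ ∧
      ∫ t, (∫ x, g x * polarDensity (lam t) x i j ∂totalVar (lam t)) ∂τ =
        ∫ x, g x * polarDensity Lam x i j ∂totalVar Lam := by
  have hPSD := isPSDValued_average hm hpsd hint hLam
  induction g using SimpleFunc.induction with
  | const c hs =>
    rename_i s
    have key : ∀ {l : MatMeasure d}, IsPSDValued l →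
        ∫ x, (SimpleFunc.piecewise s hs (SimpleFunc.const _ c) (SimpleFunc.const _ 0)) x *
          polarDensity l x i j ∂totalVar l = c * l s i j := by
      intro l hl
      rw [← setIntegral_polarDensity hl i j hs, ← integral_const_mul, ← integral_indicator hs]
      refine integral_congr_ae (ae_of_all _ fun x => ?_)
      by_cases hx : x ∈ s <;> simp [hx]
    have hae : (fun t => ∫ x, (SimpleFunc.piecewise s hs (SimpleFunc.const _ c)
        (SimpleFunc.const _ 0)) x * polarDensity (lam t) x i j ∂totalVar (lam t)) =ᵐ[τ]
          fun t => c * lam t s i j := by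
      filter_upwards [hpsd] with t ht using key ht
    refine ⟨((integrable_entry hm hpsd hint hs i j).const_mul c).congr hae.symm, ?_⟩
    rw [integral_congr_ae hae, key hPSD, integral_const_mul, hLam s hs]
  | add hdisj hf hg =>
    rename_i f g
    have hi : ∀ (l : MatMeasure d) (f : SimpleFunc (Space d) ℝ),
        Integrable (fun x => f x * polarDensity l x i j) (totalVar l) := by
      intro l f
      obtain ⟨c, hc⟩ := f.exists_forall_norm_le
      exact integrable_mul_polarDensity l i j f.stronglyMeasurable hc
    have key : ∀ l : MatMeasure d, ∫ x, (f + g) x * polarDensity l x i j ∂totalVar l =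
        ∫ x, f x * polarDensity l x i j ∂totalVar l +
          ∫ x, g x * polarDensity l x i j ∂totalVar l := by
      intro l
      rw [← integral_add (hi l f) (hi l g)]
      simp only [SimpleFunc.coe_add, Pi.add_apply, add_mul]
    simp only [key]
    exact ⟨hf.1.add hg.1, by rw [integral_add hf.1 hg.1, hf.2, hg.2]⟩

/-- Bounded simple approximations of `g` give convergence for each fixed `t`, hence measurability in
`t`, and then dominated convergence in `t` with the trace as majorant. -/
theorem integral_average
    (hm : ∀ B, MeasurableSet B → ∀ i j, AEMeasurable (fun t => lam t B i j) τ)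
    (hpsd : ∀ᵐ t ∂τ, IsPSDValued (lam t))
    (hint : Integrable (fun t => (lam t univ).trace) τ)
    (hLam : ∀ B, MeasurableSet B → ∀ i j, Lam B i j = ∫ t, lam t B i j ∂τ)
    (i j : Fin d) {g : Space d → ℝ} (hg : StronglyMeasurable g) {c : ℝ} (hc : ∀ x, ‖g x‖ ≤ c) :
    Integrable (fun t => ∫ x, g x * polarDensity (lam t) x i j ∂totalVar (lam t)) τ ∧
      ∫ t, (∫ x, g x * polarDensity (lam t) x i j ∂totalVar (lam t)) ∂τ =
        ∫ x, g x * polarDensity Lam x i j ∂totalVar Lam := by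
  have hc0 : 0 ≤ c := (norm_nonneg _).trans (hc 0)
  let G := hg.approxBounded c
  have hGc : ∀ n x, ‖G n x‖ ≤ c := fun n x => hg.norm_approxBounded_le hc0 n x
  have hlim : ∀ l : MatMeasure d,
      Tendsto (fun n => ∫ x, G n x * polarDensity l x i j ∂totalVar l) atTop
        (𝓝 (∫ x, g x * polarDensity l x i j ∂totalVar l)) := by
    intro l
    refine tendsto_integral_of_dominated_convergence (fun x => c * |polarDensity l x i j|)
      (fun n => (integrable_mul_polarDensity l i j (G n).stronglyMeasurable
        (hGc n)).aestronglyMeasurable)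
      ((integrable_polarDensity l i j).abs.const_mul c) (fun n => ae_of_all _ fun x => ?_)
      (ae_of_all _ fun x => ?_)
    · rw [norm_mul]
      exact mul_le_mul_of_nonneg_right (hGc n x) (norm_nonneg _)
    · exact (hg.tendsto_approxBounded_of_norm_le (hc x)).mul_const _
  have hs := fun n => integral_average_simpleFunc hm hpsd hint hLam i j (G n)
  have hbound : Integrable (fun t => c * (2 * (lam t univ).trace)) τ :=
    (hint.const_mul 2).const_mul c
  refine ⟨hbound.mono' (aestronglyMeasurable_of_tendsto_ae atTop
    (fun n => (hs n).1.aestronglyMeasurable) (ae_of_all _ fun t => hlim (lam t))) ?_, ?_⟩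
  · filter_upwards [hpsd] with t ht using norm_integral_mul_polarDensity_le ht i j hc
  · have h1 : Tendsto (fun n => ∫ t, (∫ x, G n x * polarDensity (lam t) x i j ∂totalVar (lam t)) ∂τ)
        atTop (𝓝 (∫ t, (∫ x, g x * polarDensity (lam t) x i j ∂totalVar (lam t)) ∂τ)) := by
      refine tendsto_integral_of_dominated_convergence _
        (fun n => (hs n).1.aestronglyMeasurable) hbound (fun n => ?_)
        (ae_of_all _ fun t => hlim (lam t))
      filter_upwards [hpsd] with t ht using norm_integral_mul_polarDensity_le ht i j (hGc n)
    simp only [(hs _).2] at h1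
    exact tendsto_nhds_unique h1 (hlim Lam)

theorem matIntegral_eq_sum (l : MatMeasure d) {ξ : Space d → Mat d}
    (hξ : ∀ i j, StronglyMeasurable fun x => ξ x i j) {c : ℝ} (hc : ∀ x i j, ‖ξ x i j‖ ≤ c) :
    matIntegral ξ l = ∑ i, ∑ j, ∫ x, ξ x i j * polarDensity l x i j ∂totalVar l := by
  have h := fun i j => integrable_mul_polarDensity l i j (hξ i j) (fun x => hc x i j)
  simp only [matIntegral, frob_eq_sum]
  refine (integral_finsetSum _ fun i _ => integrable_finsetSum _ fun j _ => h i j).trans ?_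
  exact Finset.sum_congr rfl fun i _ => integral_finsetSum _ fun j _ => h i j

theorem matIntegral_average
    (hm : ∀ B, MeasurableSet B → ∀ i j, AEMeasurable (fun t => lam t B i j) τ)
    (hpsd : ∀ᵐ t ∂τ, IsPSDValued (lam t))
    (hint : Integrable (fun t => (lam t univ).trace) τ)
    (hLam : ∀ B, MeasurableSet B → ∀ i j, Lam B i j = ∫ t, lam t B i j ∂τ)
    {ξ : Space d → Mat d} (hξ : ∀ i j, StronglyMeasurable fun x => ξ x i j) {c : ℝ}
    (hc : ∀ x i j, ‖ξ x i j‖ ≤ c) :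
    Integrable (fun t => matIntegral ξ (lam t)) τ ∧
      ∫ t, matIntegral ξ (lam t) ∂τ = matIntegral ξ Lam := by
  have h := fun i j => integral_average hm hpsd hint hLam i j (hξ i j) (fun x => hc x i j)
  simp only [matIntegral_eq_sum _ hξ hc]
  refine ⟨integrable_finsetSum _ fun i _ => integrable_finsetSum _ fun j _ => (h i j).1, ?_⟩
  rw [integral_finsetSum _ fun i _ => integrable_finsetSum _ fun j _ => (h i j).1]
  refine Finset.sum_congr rfl fun i _ => ?_
  rw [integral_finsetSum _ fun j _ => (h i j).1]
  exact Finset.sum_congr rfl fun j _ => (h i j).2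

end Average

/-! ### Time cut-offs and weak derivatives -/

theorem contDiff_smoothTransition_deriv : ContDiff ℝ 1 (deriv Real.smoothTransition) :=
  ((contDiff_succ_iff_deriv (n := 1)).1
    (Real.smoothTransition.contDiff (n := 2))).2.2

/-- The transition takes its minimum 0 or its maximum 1 at such points, the ends of the interval
included. -/
theorem deriv_smoothTransition_of_notMem {s : ℝ} (hs : s ∉ Ioo (0 : ℝ) 1) :
    deriv Real.smoothTransition s = 0 := by
  rcases le_or_gt s 0 with h | h
  · refine IsLocalMin.deriv_eq_zero (Eventually.of_forall fun y => ?_)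
    rw [Real.smoothTransition.zero_of_nonpos h]
    exact Real.smoothTransition.nonneg y
  · have h1 : 1 ≤ s := not_lt.1 fun h1 => hs ⟨h, h1⟩
    refine IsLocalMax.deriv_eq_zero (Eventually.of_forall fun y => ?_)
    rw [Real.smoothTransition.one_of_one_le h1]
    exact Real.smoothTransition.le_one y

theorem hasDerivAt_smoothTransition (s : ℝ) :
    HasDerivAt Real.smoothTransition (deriv Real.smoothTransition s) s :=
  ((Real.smoothTransition.contDiff (n := 1)).differentiable (by norm_num) s).hasDerivAt

theorem integrable_deriv_smoothTransition : Integrable (deriv Real.smoothTransition) := by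
  refine contDiff_smoothTransition_deriv.continuous.integrable_of_hasCompactSupport ?_
  exact HasCompactSupport.intro (isCompact_Icc (a := (0 : ℝ)) (b := 1)) fun s hs =>
    deriv_smoothTransition_of_notMem fun h => hs (Ioo_subset_Icc_self h)

theorem integral_deriv_smoothTransition : ∫ s, deriv Real.smoothTransition s = 1 := by
  have h := integral_of_hasDerivAt_of_tendsto hasDerivAt_smoothTransition
    integrable_deriv_smoothTransition (m := 0) (n := 1) ?_ ?_
  · simpa using h
  · refine tendsto_const_nhds.congr' ?_
    filter_upwards [eventually_le_atBot 0] with s hs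
    rw [Real.smoothTransition.zero_of_nonpos hs]
  · refine tendsto_const_nhds.congr' ?_
    filter_upwards [eventually_ge_atTop 1] with s hs
    rw [Real.smoothTransition.one_of_one_le hs]

/-- The kernel has mass 1 and lives on `[1/n, 2/n]`: it is an approximate identity at `0`, as the
substitution `s = n t - 1` shows. -/
theorem tendsto_integral_deriv_smoothTransition_mul {g : ℝ → ℝ} (hg : Continuous g) {c : ℝ}
    (hc : ∀ t, ‖g t‖ ≤ c) :
    Tendsto (fun n : ℕ => ∫ t, n * deriv Real.smoothTransition (n * t - 1) * g t) atTop
      (𝓝 (g 0)) := by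
  have h1 : Tendsto (fun n : ℕ => ∫ s, deriv Real.smoothTransition s * g ((s + 1) / n)) atTop
      (𝓝 (∫ s, deriv Real.smoothTransition s * g 0)) := by
    refine tendsto_integral_of_dominated_convergence
      (fun s => ‖deriv Real.smoothTransition s‖ * c)
      (fun n => ?_) (integrable_deriv_smoothTransition.norm.mul_const c)
      (fun n => ae_of_all _ fun s => ?_) (ae_of_all _ fun s => ?_)
    · exact (contDiff_smoothTransition_deriv.continuous.mul
        (hg.comp (by fun_prop))).aestronglyMeasurable
    · rw [norm_mul]
      exact mul_le_mul_of_nonneg_left (hc _) (norm_nonneg _)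
    · refine Tendsto.const_mul _ ((hg.tendsto 0).comp ?_)
      exact tendsto_const_nhds.div_atTop tendsto_natCast_atTop_atTop
  rw [integral_mul_const, integral_deriv_smoothTransition, one_mul] at h1
  refine h1.congr' ?_
  filter_upwards [eventually_gt_atTop 0] with n hn
  have hn' : (0 : ℝ) < n := Nat.cast_pos.2 hn
  have e1 := integral_sub_right_eq_self
    (fun s => deriv Real.smoothTransition s * g ((s + 1) / n)) (μ := volume) (1 : ℝ)
  have e2 := Measure.integral_comp_mul_left
    (fun s => deriv Real.smoothTransition (s - 1) * g ((s - 1 + 1) / n)) (n : ℝ)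
  rw [← e1]
  rw [abs_of_pos (inv_pos.2 hn'), smul_eq_mul, ← div_eq_inv_mul, eq_div_iff hn'.ne'] at e2
  rw [← e2, mul_comm, ← integral_const_mul]
  refine integral_congr_ae (ae_of_all _ fun t => ?_)
  simp only [sub_add_cancel, mul_div_cancel_left₀ t hn'.ne', mul_assoc]

/-- A smooth cut-off in time, equal to `1` on `[2/n, 1 - 2/n]` and to `0` off `[1/n, 1 - 1/n]`. -/
def timeCutoff (n : ℕ) (t : ℝ) : ℝ :=
  Real.smoothTransition (n * t - 1) + Real.smoothTransition (n * (1 - t) - 1) - 1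

theorem contDiff_timeCutoff (n : ℕ) : ContDiff ℝ 2 (timeCutoff n) :=
  ((Real.smoothTransition.contDiff.comp (by fun_prop)).add
    (Real.smoothTransition.contDiff.comp (by fun_prop))).sub contDiff_const

theorem timeCutoff_eq_zero {n : ℕ} (hn : 3 ≤ n) {t : ℝ}
    (ht : t ∉ Icc (1 / n : ℝ) (1 - 1 / n)) : timeCutoff n t = 0 := by
  have hn3 : (3 : ℝ) ≤ n := by exact_mod_cast hn
  have hn0 : (0 : ℝ) < n := by linarith
  unfold timeCutoff
  rcases lt_or_ge t (1 / n) with h | h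
  · have h1 : n * t < 1 := by rwa [lt_div_iff₀' hn0] at h
    -- Here `n (1 - t) - 1 > n - 2 ≥ 1`, so the other transition is already complete; this is where
    -- `3 ≤ n` enters.
    rw [Real.smoothTransition.zero_of_nonpos (by linarith),
      Real.smoothTransition.one_of_one_le (by nlinarith)]
    norm_num
  · have h2 : 1 - 1 / n < t := not_le.1 fun h2 => ht ⟨h, h2⟩
    have h1 : n * (1 - t) < 1 := by rw [← lt_div_iff₀' hn0]; linarith
    rw [Real.smoothTransition.zero_of_nonpos (x := n * (1 - t) - 1) (by linarith),
      Real.smoothTransition.one_of_one_le (by nlinarith)]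
    norm_num

theorem tsupport_timeCutoff {n : ℕ} (hn : 3 ≤ n) :
    tsupport (timeCutoff n) ⊆ Icc (1 / n : ℝ) (1 - 1 / n) :=
  closure_minimal (fun _ ht => by_contra fun h => ht (timeCutoff_eq_zero hn h)) isClosed_Icc

theorem tsupport_timeCutoff_subset_Ioo {n : ℕ} (hn : 3 ≤ n) :
    tsupport (timeCutoff n) ⊆ Ioo 0 1 := by
  have hn0 : (0 : ℝ) < n := by exact_mod_cast (by omega : 0 < n)
  have : (0 : ℝ) < 1 / n := by positivity
  exact (tsupport_timeCutoff hn).trans (Icc_subset_Ioo this (by linarith))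

theorem hasCompactSupport_timeCutoff {n : ℕ} (hn : 3 ≤ n) : HasCompactSupport (timeCutoff n) :=
  isCompact_Icc.of_isClosed_subset (isClosed_tsupport _) (tsupport_timeCutoff hn)

theorem norm_timeCutoff_le_one (n : ℕ) (t : ℝ) : ‖timeCutoff n t‖ ≤ 1 := by
  have h1 := Real.smoothTransition.nonneg (n * t - 1)
  have h2 := Real.smoothTransition.nonneg (n * (1 - t) - 1)
  have h3 := Real.smoothTransition.le_one (n * t - 1)
  have h4 := Real.smoothTransition.le_one (n * (1 - t) - 1)
  rw [Real.norm_eq_abs, abs_le, timeCutoff]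
  constructor <;> linarith

theorem hasDerivAt_timeCutoff (n : ℕ) (t : ℝ) :
    HasDerivAt (timeCutoff n) (n * deriv Real.smoothTransition (n * t - 1) -
      n * deriv Real.smoothTransition (n * (1 - t) - 1)) t := by
  have h1 : HasDerivAt (fun t : ℝ => n * t - 1) (n : ℝ) t := by
    simpa using ((hasDerivAt_id t).const_mul (n : ℝ)).sub_const 1
  have h2 : HasDerivAt (fun t : ℝ => n * (1 - t) - 1) (-n : ℝ) t := by
    simpa using (((hasDerivAt_id t).const_sub 1).const_mul (n : ℝ)).sub_const 1
  have h := (((hasDerivAt_smoothTransition _).comp t h1).add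
    ((hasDerivAt_smoothTransition _).comp t h2)).sub_const 1
  convert! h using 1
  ring

theorem tendsto_timeCutoff {t : ℝ} (ht : t ∈ Ioo (0 : ℝ) 1) :
    Tendsto (fun n => timeCutoff n t) atTop (𝓝 1) := by
  have h : ∀ {s : ℝ}, 0 < s → ∀ᶠ n : ℕ in atTop, Real.smoothTransition (n * s - 1) = 1 := by
    intro s hs
    filter_upwards [(tendsto_natCast_atTop_atTop.atTop_mul_const hs).eventually_ge_atTop 2]
      with n hn
    exact Real.smoothTransition.one_of_one_le (by linarith)
  refine tendsto_const_nhds.congr' ?_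
  filter_upwards [h ht.1, h (sub_pos.2 ht.2)] with n h1 h2
  rw [timeCutoff, h1, h2]
  norm_num

/-- A continuous function on `[0, 1]` with an integrable weak derivative on `(0, 1)` satisfies the
fundamental theorem of calculus. -/
theorem sub_eq_integral_of_weak_deriv {g h : ℝ → ℝ} (hg : ContinuousOn g (Icc 0 1))
    (hh : Integrable h timeMeasure)
    (hweak : ∀ η : ℝ → ℝ, ContDiff ℝ 2 η → HasCompactSupport η → tsupport η ⊆ Ioo 0 1 →
      ∫ t, deriv η t * g t ∂timeMeasure = -∫ t, η t * h t ∂timeMeasure) :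
    g 1 - g 0 = ∫ t, h t ∂timeMeasure := by
  -- Extending `g` by its end values gives a bounded continuous function on the line, to which the
  -- approximate identity applies.
  let G : ℝ → ℝ := IccExtend (zero_le_one (α := ℝ)) (domRestrict (Icc 0 1) g)
  have hG : Continuous G := hg.domRestrict.Icc_extend'
  have hGg : ∀ t ∈ Icc (0 : ℝ) 1, G t = g t := fun t ht => IccExtend_of_mem _ _ ht
  obtain ⟨c, hc⟩ : ∃ c, ∀ t, ‖G t‖ ≤ c := by
    obtain ⟨c, hc⟩ := isCompact_Icc.exists_bound_of_continuousOn hg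
    exact ⟨c, fun t => hc _ (projIcc 0 1 zero_le_one t).2⟩
  have l0 := tendsto_integral_deriv_smoothTransition_mul hG hc
  have l1 := tendsto_integral_deriv_smoothTransition_mul (g := fun t => G (1 - t))
    (hG.comp (by fun_prop)) (fun t => hc (1 - t))
  have hsub : ∀ n : ℕ, ∫ t, n * deriv Real.smoothTransition (n * t - 1) * G (1 - t) =
      ∫ t, n * deriv Real.smoothTransition (n * (1 - t) - 1) * G t := by
    intro n
    rw [← integral_sub_left_eq_self _ volume (1 : ℝ)]
    simp only [sub_sub_cancel]
  have hint : ∀ n : ℕ, 0 < n → ∀ {g' : ℝ → ℝ}, Continuous g' → (∀ t, ‖g' t‖ ≤ c) →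
      Integrable fun t => n * deriv Real.smoothTransition (n * t - 1) * g' t := by
    intro n hn g' hg' hc'
    have hn' : (n : ℝ) ≠ 0 := by exact_mod_cast hn.ne'
    exact (((integrable_deriv_smoothTransition.comp_sub_right 1).comp_mul_left' hn').const_mul
      (n : ℝ)).mul_bdd hg'.aestronglyMeasurable (ae_of_all _ hc')
  -- The derivative of the cut-off is a unit bump near `0` minus its reflection near `1`.
  have lim1 : Tendsto (fun n : ℕ => ∫ t, deriv (timeCutoff n) t * g t ∂timeMeasure) atTop
      (𝓝 (g 0 - g 1)) := by
    have := l0.sub l1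
    simp only [sub_zero] at this
    rw [hGg 0 (by simp), hGg 1 (by simp)] at this
    refine this.congr' ?_
    filter_upwards [eventually_ge_atTop 3] with n hn
    have i1 := hint n (by omega) hG hc
    have i2 := (hint n (by omega) (g' := fun t => G (1 - t)) (hG.comp (by fun_prop))
      (fun t => hc (1 - t))).comp_sub_left 1
    simp only [sub_sub_cancel] at i2
    rw [hsub, ← integral_sub i1 i2]
    have e : ∫ t, deriv (timeCutoff n) t * g t ∂timeMeasure =
        ∫ t in Ioo 0 1, deriv (timeCutoff n) t * G t :=
      setIntegral_congr_fun measurableSet_Ioo fun t ht => by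
        simp only [hGg t (Ioo_subset_Icc_self ht)]
    rw [e, setIntegral_eq_integral_of_forall_compl_eq_zero]
    · refine integral_congr_ae (ae_of_all _ fun t => ?_)
      simp only [(hasDerivAt_timeCutoff n t).deriv, sub_mul]
    · intro t ht
      have : t ∉ tsupport (deriv (timeCutoff n)) := fun h =>
        ht (tsupport_timeCutoff_subset_Ioo hn (tsupport_deriv_subset h))
      rw [image_eq_zero_of_notMem_tsupport this, zero_mul]
  have lim2 : Tendsto (fun n : ℕ => ∫ t, timeCutoff n t * h t ∂timeMeasure) atTop
      (𝓝 (∫ t, h t ∂timeMeasure)) := by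
    refine tendsto_integral_of_dominated_convergence (fun t => ‖h t‖)
      (fun n => ((contDiff_timeCutoff n).continuous.aestronglyMeasurable).mul
        hh.aestronglyMeasurable) hh.norm
      (fun n => ae_of_all _ fun t => ?_) ?_
    · rw [norm_mul]
      exact mul_le_of_le_one_left (norm_nonneg _) (norm_timeCutoff_le_one n t)
    · refine (ae_restrict_iff' measurableSet_Ioo).2 (ae_of_all _ fun t ht => ?_)
      simpa using (tendsto_timeCutoff ht).mul_const (h t)
  have lim3 : Tendsto (fun n : ℕ => ∫ t, deriv (timeCutoff n) t * g t ∂timeMeasure) atTop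
      (𝓝 (-∫ t, h t ∂timeMeasure)) := by
    refine lim2.neg.congr' ?_
    filter_upwards [eventually_ge_atTop 3] with n hn
    exact (hweak _ (contDiff_timeCutoff n) (hasCompactSupport_timeCutoff hn)
      (tsupport_timeCutoff_subset_Ioo hn)).symm
  linarith [tendsto_nhds_unique lim1 lim3]

/-! ### From dynamic to static competitors -/

theorem continuous_hessian {φ : Space d → ℝ} (hφ : ContDiff ℝ 2 φ) (i j : Fin d) :
    Continuous fun x => hessian φ x i j :=
  (ContinuousMultilinearMap.apply ℝ (fun _ : Fin 2 => Space d) ℝ _).continuous.comp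
    (hφ.continuous_iteratedFDeriv le_rfl)

theorem exists_bound_hessian {φ : Space d → ℝ} (hφ : ContDiff ℝ 2 φ) (hc : HasCompactSupport φ) :
    ∃ c, ∀ x i j, ‖hessian φ x i j‖ ≤ c := by
  obtain ⟨c, hb⟩ := (hφ.continuous_iteratedFDeriv le_rfl).bounded_above_of_compact_support
    (hc.iteratedFDeriv 2)
  refine ⟨c, fun x i j => ?_⟩
  have h := (iteratedFDeriv ℝ 2 φ x).le_opNorm
    ![EuclideanSpace.single i (1 : ℝ), EuclideanSpace.single j (1 : ℝ)]
  rw [Fin.prod_univ_two] at h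
  simp only [Matrix.cons_val_zero, Matrix.cons_val_one, PiLp.norm_single, norm_one,
    mul_one] at h
  exact h.trans (hb x)

theorem hessian_const_mul {ψ : Space d → ℝ} (hψ : ContDiff ℝ 2 ψ) (c : ℝ) (x : Space d) :
    hessian (fun y => c * ψ y) x = c • hessian ψ x := by
  ext i j
  have := iteratedFDeriv_const_smul_apply (𝕜 := ℝ) (i := 2) (a := c) (x := x) hψ.contDiffAt
  simp only [hessian, Matrix.of_apply, Matrix.smul_apply]
  rw [show (fun y => c * ψ y) = c • ψ from rfl, this]
  rfl

theorem matIntegral_const_smul (c : ℝ) (ξ : Space d → Mat d) (l : MatMeasure d) :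
    matIntegral (fun x => c • ξ x) l = c * matIntegral ξ l := by
  rw [matIntegral, matIntegral, ← integral_const_mul]
  congr 1
  funext x
  simp [frob]

theorem totalVar_compl_eq_zero {l : MatMeasure d} {X : Set (Space d)}
    (h : (totalVar l).support ⊆ X) : totalVar l Xᶜ = 0 :=
  measure_mono_null (compl_subset_compl.2 h) Measure.measure_compl_support

theorem abs_trace_le (A : Mat d) : |A.trace| ≤ d * frobNorm A := by
  refine (Finset.abs_sum_le_sum_abs _ _).trans ?_
  refine (Finset.sum_le_sum fun i _ => abs_entry_le_frobNorm A i i).trans ?_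
  simp

/-- As `λ_t` lives on the compact `X`, local finiteness applied to `X` bounds all of its mass. -/
theorem SolvesFPE.integrable_trace_univ {rho : ℝ → Measure (Space d)} {lam : ℝ → MatMeasure d}
    (h : SolvesFPE rho lam) {X : Set (Space d)} (hX : IsCompact X)
    (hs : ∀ᵐ t ∂timeMeasure, (totalVar (lam t)).support ⊆ X) :
    Integrable (fun t => (lam t univ).trace) timeMeasure := by
  refine ⟨(aemeasurable_trace h.lam_measurable MeasurableSet.univ).aestronglyMeasurable, ?_⟩
  refine lt_of_le_of_lt ?_
    (ENNReal.mul_lt_top (ENNReal.natCast_lt_top d) (h.lam_locallyFinite X hX))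
  rw [← lintegral_const_mul' _ _ (ENNReal.natCast_ne_top d)]
  refine lintegral_mono_ae ?_
  filter_upwards [hs] with t ht
  rw [← ofReal_norm]
  refine (ENNReal.ofReal_le_ofReal (abs_trace_le _)).trans ?_
  rw [ENNReal.ofReal_mul (Nat.cast_nonneg d), ENNReal.ofReal_natCast]
  gcongr
  refine (ofReal_frobNorm_le_totalVar _ _).trans ?_
  rw [← measure_add_measure_compl hX.measurableSet, totalVar_compl_eq_zero ht, add_zero]

theorem contDiff_timeTest {η : ℝ → ℝ} {ψ : Space d → ℝ} (hη : ContDiff ℝ 2 η)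
    (hψ : ContDiff ℝ 2 ψ) : ContDiff ℝ 2 fun p : ℝ × Space d => η p.1 * ψ p.2 :=
  (hη.comp contDiff_fst).mul (hψ.comp contDiff_snd)

theorem tsupport_timeTest_subset (η : ℝ → ℝ) (ψ : Space d → ℝ) :
    tsupport (fun p : ℝ × Space d => η p.1 * ψ p.2) ⊆ tsupport η ×ˢ tsupport ψ := by
  refine closure_minimal (fun p hp => ?_) ((isClosed_tsupport η).prod (isClosed_tsupport ψ))
  exact ⟨subset_tsupport η (left_ne_zero_of_mul hp), subset_tsupport ψ (right_ne_zero_of_mul hp)⟩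

theorem IsDynamicCompetitor.exists_solvesStatic {f : Mat d → ℝ≥0∞} (hf : IsCost f)
    {X : Set (Space d)} (hX : IsCompact X) {μ ν : Measure (Space d)}
    {rho : ℝ → Measure (Space d)} {lam : ℝ → MatMeasure d}
    (h : IsDynamicCompetitor X μ ν rho lam) :
    ∃ Lam, SolvesStatic X μ ν Lam ∧ cost f X Lam ≤ ∫⁻ t, cost f X (lam t) ∂timeMeasure := by
  have hm := h.solves.lam_measurable
  have hpsd := h.solves.lam_psd
  have hint := h.solves.integrable_trace_univ hX h.lam_support
  obtain ⟨Lam, hLam⟩ := exists_average hm hpsd hint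
  have hPSD := isPSDValued_average hm hpsd hint hLam
  refine ⟨Lam, ⟨hPSD, ?_, fun ψ hψ hψc => ?_⟩, cost_le_lintegral_cost hf hX.measurableSet hpsd hPSD
    fun B hB C => frob_average hm hpsd hint hLam hB C⟩
  · refine Measure.support_subset_of_isClosed hX.isClosed ?_
    refine totalVar_average_eq_zero hLam hPSD hX.measurableSet.compl ?_
    filter_upwards [h.lam_support] with t ht using totalVar_compl_eq_zero ht
  · obtain ⟨c, hc⟩ := exists_bound_hessian hψ hψc
    obtain ⟨hi, hI⟩ := matIntegral_average hm hpsd hint hLam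
      (ξ := fun x => (1 / 2 : ℝ) • hessian ψ x) (c := 1 / 2 * c)
      (fun i j => ((continuous_hessian hψ i j).const_smul (1 / 2 : ℝ)).stronglyMeasurable)
      (fun x i j => by
        rw [Matrix.smul_apply, norm_smul, Real.norm_of_nonneg (by norm_num)]
        exact mul_le_mul_of_nonneg_left (hc x i j) (by norm_num))
    obtain ⟨rho', -, hae, hcont, h0, h1⟩ := h.endpoints
    obtain ⟨b, hb⟩ := hψ.continuous.bounded_above_of_compact_support hψc
    let Ψ : Space d →ᵇ ℝ := BoundedContinuousFunction.ofNormedAddCommGroup ψ hψ.continuous b hb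
    -- Product test functions identify the weak time derivative; the narrowly continuous
    -- representative supplies the end values.
    have hFTC := sub_eq_integral_of_weak_deriv (hcont Ψ) hi fun η hη hηc hηs => by
      have hw := h.solves.weak_eq _ (contDiff_timeTest hη hψ)
        ((hηc.isCompact.prod hψc.isCompact).of_isClosed_subset (isClosed_tsupport _)
          (tsupport_timeTest_subset η ψ))
        ((tsupport_timeTest_subset η ψ).trans (prod_mono hηs (subset_univ _)))
      have e1 : ∫ t, deriv η t * ∫ x, Ψ x ∂rho' t ∂timeMeasure =
          ∫ t, (∫ x, deriv (fun s => η s * ψ x) t ∂rho t) ∂timeMeasure := by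
        refine integral_congr_ae ?_
        filter_upwards [hae] with t ht
        rw [ht, ← integral_const_mul]
        refine integral_congr_ae (ae_of_all _ fun x => ?_)
        exact (deriv_mul_const ((hη.differentiable (by norm_num)) t) (ψ x)).symm
      rw [e1, hw]
      congr 2
      funext t
      rw [← matIntegral_const_smul]
      congr 1
      funext x
      exact (congrArg _ (hessian_const_mul hψ (η t) x)).trans (smul_comm _ _ _)
    rw [h0, h1] at hFTC
    rw [← hI, ← hFTC]
    rfl

/-! ### From static to dynamic competitors -/

theorem hasDerivAt_integral_timeSlice {φ : ℝ × Space d → ℝ} (hφ : ContDiff ℝ 2 φ)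
    (hc : HasCompactSupport φ) (μ : Measure (Space d)) [IsFiniteMeasure μ] :
    Continuous (fun t => ∫ x, deriv (fun s => φ (s, x)) t ∂μ) ∧
    (∀ t, HasDerivAt (fun t => ∫ x, φ (t, x) ∂μ) (∫ x, deriv (fun s => φ (s, x)) t ∂μ) t) ∧
    ∀ t, Integrable (fun x => deriv (fun s => φ (s, x)) t) μ := by
  let D : ℝ × Space d → ℝ := fun p => fderiv ℝ φ p (1, 0)
  have hD : Continuous D := (hφ.continuous_fderiv (by norm_num)).clm_apply continuous_const
  have hderiv : ∀ t x, HasDerivAt (fun s => φ (s, x)) (D (t, x)) t := by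
    intro t x
    have h1 := (hφ.differentiable (by norm_num) (t, x)).hasFDerivAt
    exact h1.comp_hasDerivAt t ((hasDerivAt_id t).prodMk (hasDerivAt_const t x))
  have hDeq : ∀ t x, deriv (fun s => φ (s, x)) t = D (t, x) := fun t x => (hderiv t x).deriv
  obtain ⟨c, hcD⟩ : ∃ c, ∀ p, ‖D p‖ ≤ c :=
    hD.bounded_above_of_compact_support (hc.fderiv_apply ℝ (1, 0))
  obtain ⟨b, hb⟩ := hφ.continuous.bounded_above_of_compact_support hc
  have hDm : ∀ t, AEStronglyMeasurable (fun x => D (t, x)) μ := fun t =>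
    (hD.comp (by fun_prop)).aestronglyMeasurable
  have hφm : ∀ t, AEStronglyMeasurable (fun x => φ (t, x)) μ := fun t =>
    (hφ.continuous.comp (by fun_prop)).aestronglyMeasurable
  simp only [hDeq]
  refine ⟨?_, fun t => ?_, fun t => ?_⟩
  · exact continuous_of_dominated hDm (fun t => ae_of_all _ fun x => hcD (t, x))
      (integrable_const c) (ae_of_all _ fun x => hD.comp (by fun_prop))
  · exact (hasDerivAt_integral_of_dominated_loc_of_deriv_le (s := univ) univ_mem
      (Eventually.of_forall hφm)
      ((integrable_const b).mono' (hφm t) (ae_of_all _ fun x => hb (t, x))) (hDm t)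
      (ae_of_all _ fun x s _ => hcD (s, x)) (integrable_const c)
      (ae_of_all _ fun x s _ => hderiv s x)).2
  · exact (integrable_const c).mono' (hDm t) (ae_of_all _ fun x => hcD (t, x))

/-- The linear interpolation between `μ` and `ν`. -/
def interpolation (μ ν : Measure (Space d)) (t : ℝ) : Measure (Space d) :=
  ENNReal.ofReal (1 - t) • μ + ENNReal.ofReal t • ν

theorem integral_interpolation {μ ν : Measure (Space d)} {g : Space d → ℝ} (hμ : Integrable g μ)
    (hν : Integrable g ν) {t : ℝ} (ht : t ∈ Icc (0 : ℝ) 1) :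
    ∫ x, g x ∂interpolation μ ν t = (1 - t) * ∫ x, g x ∂μ + t * ∫ x, g x ∂ν := by
  rw [interpolation, integral_add_measure (hμ.smul_measure ENNReal.ofReal_ne_top)
    (hν.smul_measure ENNReal.ofReal_ne_top), integral_smul_measure, integral_smul_measure,
    ENNReal.toReal_ofReal (sub_nonneg.2 ht.2), ENNReal.toReal_ofReal ht.1, smul_eq_mul, smul_eq_mul]

instance isProbabilityMeasure_timeMeasure : IsProbabilityMeasure timeMeasure :=
  ⟨by simp [timeMeasure]⟩

theorem SolvesStatic.solvesFPE {X : Set (Space d)} {μ ν : Measure (Space d)} [IsFiniteMeasure μ]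
    [IsFiniteMeasure ν] {lam : MatMeasure d} (h : SolvesStatic X μ ν lam) :
    SolvesFPE (interpolation μ ν) (fun _ => lam) where
  rho_measurable B _ := by
    simp only [interpolation, Measure.add_apply, Measure.smul_apply, smul_eq_mul]
    fun_prop
  rho_finite := by
    have hle : ∀ᵐ t ∂timeMeasure, interpolation μ ν t univ ≤ μ univ + ν univ := by
      refine (ae_restrict_iff' measurableSet_Ioo).2 (ae_of_all _ fun t ht => ?_)
      simp only [interpolation, Measure.add_apply, Measure.smul_apply, smul_eq_mul]
      gcongr
      · exact mul_le_of_le_one_left zero_le (ENNReal.ofReal_le_one.2 (by linarith [ht.1]))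
      · exact mul_le_of_le_one_left zero_le (ENNReal.ofReal_le_one.2 ht.2.le)
    refine (lintegral_mono_ae hle).trans_lt ?_
    rw [lintegral_const, measure_univ (μ := timeMeasure), mul_one]
    exact ENNReal.add_lt_top.2 ⟨measure_lt_top _ _, measure_lt_top _ _⟩
  lam_measurable _ _ _ _ := aemeasurable_const
  lam_psd := ae_of_all _ fun _ => h.psd
  lam_locallyFinite K _ := by
    have := isFiniteMeasure_totalVar h.psd
    rw [lintegral_const, measure_univ, mul_one]
    exact measure_lt_top _ _
  weak_eq φ hφ hφc hφs := by
    obtain ⟨cμ, dμ, iμ⟩ := hasDerivAt_integral_timeSlice hφ hφc μ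
    obtain ⟨cν, dν, iν⟩ := hasDerivAt_integral_timeSlice hφ hφc ν
    set m : ℝ → ℝ := fun t => ∫ x, φ (t, x) ∂μ
    set n : ℝ → ℝ := fun t => ∫ x, φ (t, x) ∂ν
    set m' : ℝ → ℝ := fun t => ∫ x, deriv (fun s => φ (s, x)) t ∂μ
    set n' : ℝ → ℝ := fun t => ∫ x, deriv (fun s => φ (s, x)) t ∂ν
    have hm : Continuous m := continuous_iff_continuousAt.2 fun t => (dμ t).continuousAt
    have hn : Continuous n := continuous_iff_continuousAt.2 fun t => (dν t).continuousAt
    have hL : ∫ t, (∫ x, deriv (fun s => φ (s, x)) t ∂interpolation μ ν t) ∂timeMeasure =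
        ∫ t in (0 : ℝ)..1, ((1 - t) * m' t + t * n' t) := by
      rw [intervalIntegral.integral_of_le zero_le_one, integral_Ioc_eq_integral_Ioo]
      exact setIntegral_congr_fun measurableSet_Ioo fun t ht =>
        integral_interpolation (iμ t) (iν t) (Ioo_subset_Icc_self ht)
    -- For each frozen `t` the slice `φ(t, ·)` is admissible in the static equation.
    have hR : ∫ t, matIntegral (fun x => (1 / 2 : ℝ) • hessian (fun y => φ (t, y)) x) lam
        ∂timeMeasure = ∫ t in (0 : ℝ)..1, (n t - m t) := by
      rw [intervalIntegral.integral_of_le zero_le_one, integral_Ioc_eq_integral_Ioo]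
      refine setIntegral_congr_fun measurableSet_Ioo fun t _ => ?_
      refine h.weak_eq (fun y => φ (t, y)) (hφ.comp (by fun_prop)) ?_
      refine HasCompactSupport.intro (hφc.isCompact.image continuous_snd) fun x hx => ?_
      exact image_eq_zero_of_notMem_tsupport fun hmem => hx ⟨_, hmem, rfl⟩
    have hφ0 : ∀ t ∉ Ioo (0 : ℝ) 1, ∀ x, φ (t, x) = 0 := fun t ht x =>
      image_eq_zero_of_notMem_tsupport fun hmem => ht (hφs hmem).1
    -- The weak equation says that this derivative integrates to zero. The boundary terms are `n 1`
    -- and `m 0`, which vanish because `φ` is supported in the open time interval.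
    have hw : ∀ t, HasDerivAt (fun t => (1 - t) * m t + t * n t)
        ((1 - t) * m' t + t * n' t + (n t - m t)) t := by
      intro t
      have h1 := (((hasDerivAt_id t).const_sub 1).mul (dμ t)).add ((hasDerivAt_id t).mul (dν t))
      convert! h1 using 1
      simp only [id_eq, m, n, m', n']
      ring
    have hFTC := intervalIntegral.integral_eq_sub_of_hasDerivAt (a := 0) (b := 1)
      (fun t _ => hw t) ((by fun_prop : Continuous fun t =>
        (1 - t) * m' t + t * n' t + (n t - m t)).intervalIntegrable _ _)
    rw [intervalIntegral.integral_add
      ((by fun_prop : Continuous fun t => (1 - t) * m' t + t * n' t).intervalIntegrable _ _)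
      ((by fun_prop : Continuous fun t => n t - m t).intervalIntegrable _ _)] at hFTC
    have hm0 : m 0 = 0 := by simp [m, hφ0 0 (by simp)]
    have hn1 : n 1 = 0 := by simp [n, hφ0 1 (by simp)]
    rw [hL, hR]
    rw [hm0, hn1] at hFTC
    linarith

theorem hasEndpoints_interpolation (μ ν : Measure (Space d)) [IsFiniteMeasure μ]
    [IsFiniteMeasure ν] : HasEndpoints (interpolation μ ν) μ ν := by
  refine ⟨interpolation μ ν, fun t _ => ?_, ae_of_all _ fun _ => rfl, fun ψ => ?_, ?_, ?_⟩
  · have := Measure.smul_finite μ (ENNReal.ofReal_ne_top (r := 1 - t))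
    have := Measure.smul_finite ν (ENNReal.ofReal_ne_top (r := t))
    exact isFiniteMeasureAdd
  · refine ContinuousOn.congr (f := fun t : ℝ => (1 - t) * ∫ x, ψ x ∂μ + t * ∫ x, ψ x ∂ν)
      (by fun_prop) fun t ht => integral_interpolation (ψ.integrable μ) (ψ.integrable ν) ht
  · simp [interpolation]
  · simp [interpolation]

theorem SolvesStatic.isDynamicCompetitor {X : Set (Space d)} (hX : IsClosed X)
    {μ ν : Measure (Space d)} [IsFiniteMeasure μ] [IsFiniteMeasure ν] (hμ : μ.support ⊆ X)
    (hν : ν.support ⊆ X) {lam : MatMeasure d} (h : SolvesStatic X μ ν lam) :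
    IsDynamicCompetitor X μ ν (interpolation μ ν) (fun _ => lam) where
  solves := h.solvesFPE
  rho_support := ae_of_all _ fun t => by
    refine Measure.support_subset_of_isClosed hX ?_
    have h1 : μ Xᶜ = 0 := measure_mono_null (compl_subset_compl.2 hμ) Measure.measure_compl_support
    have h2 : ν Xᶜ = 0 := measure_mono_null (compl_subset_compl.2 hν) Measure.measure_compl_support
    simp [mem_ae_iff, interpolation, h1, h2]
  lam_support := ae_of_all _ fun _ => h.support_subset
  endpoints := hasEndpoints_interpolation μ ν

/-! ### Equality of the two values -/

theorem dynamicValue_eq_staticValue {f : Mat d → ℝ≥0∞} (hf : IsCost f) {X : Set (Space d)}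
    (hX : IsCompact X) {μ ν : Measure (Space d)} [IsFiniteMeasure μ] [IsFiniteMeasure ν]
    (hμ : μ.support ⊆ X) (hν : ν.support ⊆ X) : dynamicValue f X μ ν = staticValue f X μ ν := by
  refine le_antisymm (le_iInf₂ fun lam h => ?_) (le_iInf fun rho => le_iInf₂ fun lam h => ?_)
  · refine (iInf_le_of_le (interpolation μ ν) (iInf₂_le (fun _ => lam)
      (h.isDynamicCompetitor hX.isClosed hμ hν))).trans ?_
    -- The time interval has length 1, so a constant family costs exactly the static cost.
    rw [lintegral_const, measure_univ, mul_one]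
  · obtain ⟨Lam, hs, hle⟩ := h.exists_solvesStatic hf hX
    exact (iInf₂_le Lam hs).trans hle

end FokkerPlanckOT

end

theorem mainTheorem12 {d : ℕ} (hd : 0 < d)
    (Ω : Set (EuclideanSpace ℝ (Fin d))) (hΩ_open : IsOpen Ω) (hΩ_convex : Convex ℝ Ω)
    (hΩ_bounded : Bornology.IsBounded Ω)
    (f : Matrix (Fin d) (Fin d) ℝ → ℝ≥0∞) (hf : FokkerPlanckOT.IsCost f)
    (μ ν : Measure (EuclideanSpace ℝ (Fin d))) [IsFiniteMeasure μ] [IsFiniteMeasure ν]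
    (hμ : μ.support ⊆ closure Ω) (hν : ν.support ⊆ closure Ω)
    (hmass : μ (closure Ω) = ν (closure Ω)) :
    FokkerPlanckOT.dynamicValue f (closure Ω) μ ν =
      FokkerPlanckOT.staticValue f (closure Ω) μ ν := by
  exact FokkerPlanckOT.dynamicValue_eq_staticValue hf hΩ_bounded.isCompact_closure hμ hν
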